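/- A linear triple system on a finite vertex set $V$ is a family $\mathcal F$ of $3$-element subsets of $V$, any two distinct members of which share at most one vertex. For $W\subseteq V$ let $N(W)$ be the set of vertices $z\in V\setminus W$ for which there are distinct $x,y\in W$ with $\{x,y,z\}\in\mathcal F$, and let $\mathrm{cl}(W)$ be the smallest set $U\supseteq W$ with $N(U)=\emptyset$. The system is called spreading if $\mathrm{cl}(W)=V$ for every $W\subseteq V$ with $|W|\ge 3$ and $W\notin\mathcal F$. Let $\xi_{sp}(n)$ be the minimum number of triples in a spreading linear triple system on $n$ vertices (with $\xi_{sp}(n)=\infty$ if there is no such system). Theorem. For all sufficiently large $n$, $$0.1103\,n^2<\xi_{sp}(n).$$ Moreover, there is a function $\varepsilon:\mathbb N\to\mathbb R$ with $\varepsilon(n)\to 0$ as $n\to\infty$ such that $$\xi_{sp}(n)<\left(\frac{5}{36}+\varepsilon(n)\right)n^2$$ for every $n$ of the form $n=6p+3$ with $p$ an odd prime; in particular this inequality holds for infinitely many $n$. -/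

import Mathlib

open Filter Topology
open scoped ENNReal

namespace TripleSystem

variable {V : Type*} [DecidableEq V]

/-- A linear triple system on the vertex set `V`: a family of 3-element subsets of `V`,
any two distinct members of which share at most one vertex. -/
def IsLinear (F : Finset (Finset V)) : Prop :=
  (∀ T ∈ F, T.card = 3) ∧ ∀ S ∈ F, ∀ T ∈ F, S ≠ T → (S ∩ T).card ≤ 1

/-- The shadow (skeleton) of a triple system: the graph of the pairs of distinct vertices
that are covered by some triple. -/
def shadow (F : Finset (Finset V)) : SimpleGraph V where
  Adj x y := x ≠ y ∧ ∃ T ∈ F, x ∈ T ∧ y ∈ T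
  symm := ⟨fun _ _ h => ⟨h.1.symm, h.2.imp fun _ hT => ⟨hT.1, hT.2.2, hT.2.1⟩⟩⟩
  loopless := ⟨fun _ h => h.1 rfl⟩

/-- The set `N(W)` of neighbours of `W`: the vertices `z` outside `W` that form a triple of the
system with the two ends of some edge of the shadow inside `W`. -/
def neighbours (F : Finset (Finset V)) (W : Set V) : Set V :=
  {z | z ∉ W ∧ ∃ x ∈ W, ∃ y ∈ W, (shadow F).Adj x y ∧ ({x, y, z} : Finset V) ∈ F}

/-- The closure of `W`: the smallest superset of `W` that has no neighbours
(see `isLeast_closure`). -/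
def closure (F : Finset (Finset V)) (W : Set V) : Set V :=
  ⋂₀ {U | W ⊆ U ∧ neighbours F U = ∅}

theorem isLeast_closure (F : Finset (Finset V)) (W : Set V) :
    IsLeast {U | W ⊆ U ∧ neighbours F U = ∅} (closure F W) := by
  refine ⟨⟨Set.subset_sInter fun U hU => hU.1, ?_⟩, fun U hU => Set.sInter_subset_of_mem hU⟩
  rw [Set.eq_empty_iff_forall_notMem]
  rintro z ⟨hz, x, hx, y, hy, hxy, hT⟩
  refine hz (Set.mem_sInter.2 fun U hU => ?_)
  by_contra hzU
  have : z ∈ neighbours F U :=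
    ⟨hzU, x, Set.mem_sInter.1 hx U hU, y, Set.mem_sInter.1 hy U hU, hxy, hT⟩
  rw [hU.2] at this
  exact this

/-- A vertex set is nontrivial if it has at least 3 elements and is not a triple of the system. -/
def IsNontrivial (F : Finset (Finset V)) (W : Finset V) : Prop :=
  3 ≤ W.card ∧ W ∉ F

/-- A triple system is spreading if the closure of every nontrivial set is the whole
vertex set. -/
def IsSpreading (F : Finset (Finset V)) : Prop :=
  ∀ W : Finset V, IsNontrivial F W → closure F (W : Set V) = Set.univ

/-- `ξ_sp(n)`: the minimum number of triples in a spreading linear triple system on `n` vertices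
(`⊤` if there is no such system). -/
noncomputable def xiSp (n : ℕ) : ℕ∞ :=
  ⨅ (F : Finset (Finset (Fin n))) (_ : IsLinear F ∧ IsSpreading F), (F.card : ℕ∞)

end TripleSystem

/-! Lower bound: let d be the degree in the graph of uncovered pairs. That graph is triangle-free,
since three pairwise uncovered vertices form a closed set; and a vertex outside a triple T has a
covered pair with some vertex of T, since otherwise T with that vertex is closed. If uv is
uncovered, then u therefore lies in a separate triple with each other uncovered neighbour of v, and
the third points of these triples are new. This gives 2d(v) + d(u) ≤ n + 1
(`two_mul_degree_add_degree_le`). Summing over ordered uncovered pairs and applying Cauchy–Schwarz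
bounds the sum of the d(v) by n(n + 1)/3, so there are at least (n² - 2n)/9 triples, and 1/9 >
0.1103.

Upper bound: take six cyclically ordered copies of ℤ/p and three points at infinity. The lines are
{(i,x), (i,y), (i+1,(x+y)/2)} with x ≠ y; the triples across the three classes of one parity with
coordinate sum 0 (even) or 1 (odd); {(i,x), (mate k i,x), ∞ₖ}; and the line at infinity. Only pairs
with different coordinates in opposite classes i, i+3 stay uncovered, which leaves about 5p²
triples.

The system is spreading because any three distinct points of a proper closed set form a line. Two
points in one class act on other classes by nonzero translations, whose orbits fill a class and then
everything (`sixOp_eq_some_of_two_mem`). With at most one point per class, points in neighbouring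
classes share their coordinate, and the two different sums keep the six classes from all being met
(`exists_class_empty`); the last cases are `sixOp_eq_some_of_add_two` and `sixOp_eq_some_of_thin`.
-/

namespace TripleSystem

/-! ### Linear systems and their shadows -/

section Linear

variable {V : Type*} [DecidableEq V]

theorem IsLinear.eq_of_mem {F : Finset (Finset V)} (hF : IsLinear F) {S T : Finset V}
    (hS : S ∈ F) (hT : T ∈ F) {a b : V} (hab : a ≠ b) (haS : a ∈ S) (hbS : b ∈ S)
    (haT : a ∈ T) (hbT : b ∈ T) : S = T := by
  by_contra h
  have h1 := hF.2 S hS T hT h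
  have h2 : 1 < (S ∩ T).card := Finset.one_lt_card.2
    ⟨a, Finset.mem_inter.2 ⟨haS, haT⟩, b, Finset.mem_inter.2 ⟨hbS, hbT⟩, hab⟩
  omega

theorem IsLinear.exists_third {F : Finset (Finset V)} (hF : IsLinear F) {T : Finset V}
    (hT : T ∈ F) {a b : V} (hab : a ≠ b) (ha : a ∈ T) (hb : b ∈ T) :
    ∃ c, c ≠ a ∧ c ≠ b ∧ T = {a, b, c} := by
  obtain ⟨x, y, z, hxy, hxz, hyz, rfl⟩ := Finset.card_eq_three.1 (hF.1 T hT)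
  simp only [Finset.mem_insert, Finset.mem_singleton] at ha hb
  rcases ha with rfl | rfl | rfl <;> rcases hb with rfl | rfl | rfl
  · exact absurd rfl hab
  · exact ⟨z, hxz.symm, hyz.symm, rfl⟩
  · exact ⟨y, hxy.symm, hyz, by grind⟩
  · exact ⟨z, hyz.symm, hxz.symm, by grind⟩
  · exact absurd rfl hab
  · exact ⟨x, hxy, hxz, by grind⟩
  · exact ⟨y, hyz, hxy.symm, by grind⟩
  · exact ⟨x, hxz, hxy, by grind⟩
  · exact absurd rfl hab

theorem IsSpreading.eq_univ {F : Finset (Finset V)} (hF : IsSpreading F) {W : Finset V}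
    (hW : IsNontrivial F W) (hN : neighbours F (W : Set V) = ∅) : (W : Set V) = Set.univ :=
  Set.eq_univ_of_univ_subset <| (hF W hW).symm.subset.trans
    ((isLeast_closure F (W : Set V)).2 ⟨subset_rfl, hN⟩)

-- Each triple contains six ordered pairs, and by linearity no pair lies in two triples.
open Classical in
theorem IsLinear.six_mul_card [Fintype V] {F : Finset (Finset V)} (hF : IsLinear F) :
    6 * F.card = ∑ v, (shadow F).degree v := by
  have h1 : (F.biUnion Finset.offDiag).card = 6 * F.card := by
    rw [Finset.card_biUnion, Finset.sum_const_nat (m := 6), mul_comm]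
    · intro T hT
      simp [Finset.offDiag_card, hF.1 T hT]
    · intro S hS T hT hST
      rw [Function.onFun, Finset.disjoint_left]
      rintro ⟨a, b⟩ h h'
      rw [Finset.mem_offDiag] at h h'
      exact hST (hF.eq_of_mem hS hT h.2.2 h.1 h.2.1 h'.1 h'.2.1)
  rw [← h1]
  simp_rw [← SimpleGraph.card_neighborFinset_eq_degree]
  rw [← Finset.card_sigma]
  refine Finset.card_nbij' (fun q => ⟨q.1, q.2⟩) (fun q => (q.1, q.2)) ?_ ?_ ?_ ?_
  · rintro ⟨a, b⟩ h
    simp only [Finset.coe_biUnion, Set.mem_iUnion, Finset.mem_coe, Finset.mem_offDiag] at h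
    obtain ⟨T, hT, ha, hb, hab⟩ := h
    simp only [Finset.mem_coe, Finset.mem_sigma, Finset.mem_univ, true_and,
      SimpleGraph.mem_neighborFinset]
    exact ⟨hab, T, hT, ha, hb⟩
  · rintro ⟨a, b⟩ h
    simp only [Finset.mem_coe, Finset.mem_sigma, Finset.mem_univ, true_and,
      SimpleGraph.mem_neighborFinset] at h
    obtain ⟨hab, T, hT, ha, hb⟩ := h
    simp only [Finset.coe_biUnion, Set.mem_iUnion, Finset.mem_coe, Finset.mem_offDiag]
    exact ⟨T, hT, ha, hb, hab⟩
  · intro _ _; rfl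
  · intro _ _; rfl

end Linear

/-! ### The lower bound: degrees in the graph of uncovered pairs -/

section LowerBound

variable {V : Type*} [DecidableEq V] [Fintype V]

theorem IsSpreading.shadow_adj_of_not_adj {F : Finset (Finset V)}
    (hsp : IsSpreading F) (hV : 5 ≤ Fintype.card V) {a b c : V}
    (hab : a ≠ b) (hac : a ≠ c) (hbc : b ≠ c)
    (h1 : ¬ (shadow F).Adj a b) (h2 : ¬ (shadow F).Adj a c) : (shadow F).Adj b c := by
  by_contra h3
  have hcard : ({a, b, c} : Finset V).card = 3 := Finset.card_eq_three.2 ⟨a, b, c, hab, hac, hbc, rfl⟩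
  have hW : IsNontrivial F {a, b, c} := by
    refine ⟨hcard.ge, fun h => h1 ⟨hab, _, h, by simp, by simp⟩⟩
  have hN : neighbours F (({a, b, c} : Finset V) : Set V) = ∅ := by
    rw [Set.eq_empty_iff_forall_notMem]
    rintro z ⟨-, x, hx, y, hy, hxy, -⟩
    have := hxy.symm
    simp only [Finset.coe_insert, Finset.coe_singleton, Set.mem_insert_iff,
      Set.mem_singleton_iff] at hx hy
    have hne := hxy.ne
    rcases hx with rfl | rfl | rfl <;> rcases hy with rfl | rfl | rfl <;> 
      contradiction
  have := hsp.eq_univ hW hN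
  rw [Finset.coe_eq_univ] at this
  rw [this, Finset.card_univ] at hcard
  omega

theorem IsSpreading.exists_adj_of_mem {F : Finset (Finset V)} (hF : IsLinear F)
    (hsp : IsSpreading F) (hV : 5 ≤ Fintype.card V) {T : Finset V} (hT : T ∈ F) {v : V}
    (hv : v ∉ T) : ∃ x ∈ T, (shadow F).Adj v x := by
  by_contra! h
  have hT3 := hF.1 T hT
  have hcard : (insert v T).card = 4 := by rw [Finset.card_insert_of_notMem hv, hT3]
  have hW : IsNontrivial F (insert v T) := by
    refine ⟨by omega, fun h => ?_⟩
    have := hF.1 _ h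
    omega
  have hN : neighbours F ((insert v T : Finset V) : Set V) = ∅ := by
    rw [Set.eq_empty_iff_forall_notMem]
    rintro z ⟨hz, x, hx, y, hy, hxy, hS⟩
    rw [Finset.mem_coe, Finset.mem_insert] at hx hy hz
    rcases hx with rfl | hx
    · rcases hy with rfl | hy
      · exact hxy.ne rfl
      · exact h y hy hxy
    · rcases hy with rfl | hy
      · exact h x hx hxy.symm
      · refine hz (Or.inr ?_)
        rw [hF.eq_of_mem hT hS hxy.ne hx hy (by simp) (by simp)]
        simp
  have := hsp.eq_univ hW hN
  rw [Finset.coe_eq_univ] at this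
  rw [this, Finset.card_univ] at hcard
  omega

open Classical in
theorem IsSpreading.two_mul_degree_add_degree_le {F : Finset (Finset V)} (hF : IsLinear F)
    (hsp : IsSpreading F) (hV : 5 ≤ Fintype.card V) {u v : V} (huv : (shadow F)ᶜ.Adj v u) :
    2 * (shadow F)ᶜ.degree v + (shadow F)ᶜ.degree u ≤ Fintype.card V + 1 := by
  have key : ∀ w ∈ ((shadow F)ᶜ.neighborFinset v).erase u,
      ∃ z, z ≠ u ∧ z ≠ w ∧ ({u, w, z} : Finset V) ∈ F := by
    intro w hw
    rw [Finset.mem_erase, SimpleGraph.mem_neighborFinset] at hw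
    obtain ⟨-, T, hT, hu, hw'⟩ := hsp.shadow_adj_of_not_adj hV huv.ne hw.2.ne hw.1.symm
      huv.2 hw.2.2
    obtain ⟨z, h1, h2, rfl⟩ := hF.exists_third hT hw.1.symm hu hw'
    exact ⟨z, h1, h2, hT⟩
  choose! t ht1 ht2 ht3 using key
  set N := ((shadow F)ᶜ.neighborFinset v).erase u with hN
  have hinj : Set.InjOn t N := by
    intro w hw w' hw' h
    have e : ({u, w, t w} : Finset V) = {u, w', t w'} :=
      hF.eq_of_mem (ht3 w hw) (ht3 w' hw') (ht1 w hw).symm (by simp) (by simp) (by simp) (by simp [h])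
    have : w ∈ ({u, w', t w'} : Finset V) := by rw [← e]; simp
    simp only [Finset.mem_insert, Finset.mem_singleton] at this
    rcases this with h' | h' | h'
    · exact absurd h' (Finset.ne_of_mem_erase hw)
    · exact h'
    · exact absurd (h.trans h'.symm) (ht2 w hw)
  -- If `t w` were also in `N`, then `v` would have no covered pair with the triple `{u, w, t w}`.
  have hdisj : Disjoint N (N.image t) := by
    rw [Finset.disjoint_left]
    intro z hz hz'
    obtain ⟨w, hw, rfl⟩ := Finset.mem_image.1 hz'
    have hz1 := (SimpleGraph.mem_neighborFinset _ _ _).1 (Finset.mem_of_mem_erase hz)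
    have hw1 := (SimpleGraph.mem_neighborFinset _ _ _).1 (Finset.mem_of_mem_erase hw)
    obtain ⟨x, hx, hvx⟩ := hsp.exists_adj_of_mem hF hV (ht3 w hw) (v := v) (by
      simp [huv.ne, hw1.ne, hz1.ne])
    simp only [Finset.mem_insert, Finset.mem_singleton] at hx
    rcases hx with rfl | rfl | rfl
    exacts [huv.2 hvx, hw1.2 hvx, hz1.2 hvx]
  have hsub : N ∪ N.image t ⊆ (shadow F).neighborFinset u := by
    intro z hz
    rw [SimpleGraph.mem_neighborFinset]
    rcases Finset.mem_union.1 hz with hz | hz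
    · exact ⟨(Finset.ne_of_mem_erase hz).symm, _, ht3 z hz, by simp, by simp⟩
    · obtain ⟨w, hw, rfl⟩ := Finset.mem_image.1 hz
      exact ⟨(ht1 w hw).symm, _, ht3 w hw, by simp, by simp⟩
  have hle := Finset.card_le_card hsub
  have hNc : N.card = (shadow F)ᶜ.degree v - 1 := by
    rw [hN, Finset.card_erase_of_mem (by simpa using huv),
      SimpleGraph.card_neighborFinset_eq_degree]
  rw [Finset.card_union_of_disjoint hdisj, Finset.card_image_of_injOn hinj,
    SimpleGraph.card_neighborFinset_eq_degree, hNc] at hle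
  have h1 := SimpleGraph.degree_compl (shadow F) (v := u)
  have h2 := (shadow F).degree_lt_card_verts u
  omega

open Classical in
theorem IsSpreading.le_nine_mul_card {F : Finset (Finset V)} (hF : IsLinear F)
    (hsp : IsSpreading F) (hV : 5 ≤ Fintype.card V) :
    (Fintype.card V : ℝ) ^ 2 - 2 * Fintype.card V ≤ 9 * F.card := by
  set n := Fintype.card V with hn
  set d : V → ℝ := fun v => ((shadow F)ᶜ.degree v : ℝ) with hd
  have hdeg : ∀ v, ((shadow F).degree v : ℝ) = n - 1 - d v := by
    intro v
    have h1 := SimpleGraph.degree_compl (shadow F) (v := v)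
    have h2 := (shadow F).degree_lt_card_verts v
    have h3 : (shadow F)ᶜ.degree v + 1 + (shadow F).degree v = n := by omega
    have h4 : (((shadow F)ᶜ.degree v + 1 + (shadow F).degree v : ℕ) : ℝ) = n := by rw [h3]
    push_cast at h4
    simp only [hd]
    linarith
  have hsix : (6 : ℝ) * F.card = n * (n - 1) - ∑ v, d v := by
    have := congrArg (Nat.cast : ℕ → ℝ) hF.six_mul_card
    push_cast at this
    rw [this, Finset.sum_congr rfl fun v _ => hdeg v, Finset.sum_sub_distrib]
    simp [hn]
    ring
  have hadj : ∀ v, ∑ u, (if (shadow F)ᶜ.Adj v u then (2 * d v + d u) else 0) ≤ (n + 1) * d v := by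
    intro v
    rw [← Finset.sum_filter]
    calc _ ≤ ∑ u ∈ Finset.univ.filter ((shadow F)ᶜ.Adj v), ((n : ℝ) + 1) := by
          refine Finset.sum_le_sum fun u hu => ?_
          have := hsp.two_mul_degree_add_degree_le hF hV (Finset.mem_filter.1 hu).2
          simp only [hd]
          exact_mod_cast this
      _ = (n + 1) * d v := by
          rw [Finset.sum_const, nsmul_eq_mul, mul_comm, ← SimpleGraph.neighborFinset_eq_filter,
            SimpleGraph.card_neighborFinset_eq_degree]
  have hcount : ∀ v, ∑ u, (if (shadow F)ᶜ.Adj v u then d v else 0) = d v ^ 2 := by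
    intro v
    rw [← Finset.sum_filter, Finset.sum_const, nsmul_eq_mul, ← SimpleGraph.neighborFinset_eq_filter,
            SimpleGraph.card_neighborFinset_eq_degree, sq]
  have htot : 3 * ∑ v, d v ^ 2 ≤ (n + 1) * ∑ v, d v := by
    rw [Finset.mul_sum _ _ ((n : ℝ) + 1)]
    -- Over ordered pairs, each endpoint's degree sums to `∑ v, d v ^ 2`, so the weights 2 and 1 add
    -- up to 3.
    refine le_trans (le_of_eq ?_) (Finset.sum_le_sum fun v _ => hadj v)
    have e1 : ∀ v u, (if (shadow F)ᶜ.Adj v u then (2 * d v + d u) else 0) =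
        2 * (if (shadow F)ᶜ.Adj v u then d v else 0) + (if (shadow F)ᶜ.Adj u v then d u else 0) := by
      intro v u
      simp only [(shadow F)ᶜ.adj_comm u v]
      split_ifs <;> simp
    simp_rw [e1, Finset.sum_add_distrib, ← Finset.mul_sum]
    rw [Finset.sum_comm (f := fun v u => if (shadow F)ᶜ.Adj u v then d u else 0)]
    simp_rw [hcount]
    ring
  have hcs : (∑ v, d v) ^ 2 ≤ n * ∑ v, d v ^ 2 := by
    simpa [hn] using sq_sum_le_card_mul_sum_sq (s := (Finset.univ : Finset V)) (f := d)
  have hD0 : 0 ≤ ∑ v, d v := Finset.sum_nonneg fun v _ => by simp [hd]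
  have hnp : (0 : ℝ) ≤ n := by positivity
  have hD : 3 * ∑ v, d v ≤ n * (n + 1) := by
    -- The bound comes from cancelling a factor `∑ v, d v`, so the zero case is separate.
    rcases hD0.eq_or_lt with h | h
    · rw [← h]; nlinarith
    · refine le_of_mul_le_mul_right ?_ h
      have := mul_le_mul_of_nonneg_left htot hnp
      nlinarith
  linarith

end LowerBound

/-! ### Triple systems as partial Steiner operations -/

section Operation

variable {V : Type*}

/-- A partial Steiner operation: `f u v` is the third point on the line through `u` and `v`,
if there is such a line. -/
structure IsSteinerOp (f : V → V → Option V) : Prop where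
  irrefl : ∀ u, f u u = none
  comm : ∀ u v, f u v = f v u
  invol : ∀ u v w, f u v = some w → f u w = some v

/-- Every closed set containing three distinct points not on a line is everything. -/
def IsSpreadingOp (f : V → V → Option V) : Prop :=
  ∀ U : Set V, (∀ u ∈ U, ∀ v ∈ U, ∀ w, f u v = some w → w ∈ U) →
    ∀ x ∈ U, ∀ y ∈ U, ∀ z ∈ U, x ≠ y → x ≠ z → y ≠ z → f x y ≠ some z → U = Set.univ

/-- An operation transported along an equivalence. -/
def conjOp {W : Type*} (e : W ≃ V) (f : V → V → Option V) (u v : W) : Option W :=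
  (f (e u) (e v)).map e.symm

theorem conjOp_eq_some {W : Type*} (e : W ≃ V) (f : V → V → Option V) (u v w : W) :
    conjOp e f u v = some w ↔ f (e u) (e v) = some (e w) := by
  simp only [conjOp, Option.map_eq_some_iff]
  constructor
  · rintro ⟨a, h, rfl⟩
    simpa using h
  · intro h
    exact ⟨_, h, by simp⟩

theorem IsSteinerOp.conj {W : Type*} (e : W ≃ V) {f : V → V → Option V} (hf : IsSteinerOp f) :
    IsSteinerOp (conjOp e f) where
  irrefl u := by simp [conjOp, hf.irrefl]
  comm u v := by simp [conjOp, hf.comm (e u)]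
  invol u v w h := by
    rw [conjOp_eq_some] at h ⊢
    exact hf.invol _ _ _ h

theorem IsSpreadingOp.conj {W : Type*} (e : W ≃ V) {f : V → V → Option V} (hf : IsSpreadingOp f) :
    IsSpreadingOp (conjOp e f) := by
  intro U hU x hx y hy z hz hxy hxz hyz hxyz
  have := hf (e.symm ⁻¹' U) (fun u hu v hv w h => hU _ hu _ hv _ (by
      rw [conjOp_eq_some]; simpa using h))
    (e x) (by simpa) (e y) (by simpa) (e z) (by simpa) (by simpa) (by simpa) (by simpa)
    (by rwa [Ne, conjOp_eq_some] at hxyz)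
  ext a
  have h : e a ∈ e.symm ⁻¹' U := by rw [this]; trivial
  simpa using h

theorem IsSteinerOp.ne {f : V → V → Option V} (hf : IsSteinerOp f) {u v w : V}
    (h : f u v = some w) : u ≠ v ∧ u ≠ w ∧ v ≠ w := by
  have key : ∀ {u v w : V}, f u v = some w → u ≠ v := by
    rintro u v w h rfl
    simp [hf.irrefl] at h
  refine ⟨key h, key (hf.invol _ _ _ h), key (hf.invol _ _ _ (hf.comm u v ▸ h))⟩

variable [Fintype V] [DecidableEq V]

open Classical in
/-- The triple system formed by the lines of an operation. -/
noncomputable def lines (f : V → V → Option V) : Finset (Finset V) :=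
  Finset.univ.filter fun T => ∃ u v w, f u v = some w ∧ T = {u, v, w}

theorem mem_lines {f : V → V → Option V} {T : Finset V} :
    T ∈ lines f ↔ ∃ u v w, f u v = some w ∧ T = {u, v, w} := by
  simp [lines]

theorem IsSteinerOp.eq_of_mem_lines {f : V → V → Option V} (hf : IsSteinerOp f) {T : Finset V}
    (hT : T ∈ lines f) {a b : V} (hab : a ≠ b) (ha : a ∈ T) (hb : b ∈ T) :
    ∃ c, f a b = some c ∧ T = {a, b, c} := by
  obtain ⟨u, v, w, h, rfl⟩ := mem_lines.1 hT
  have h1 : f v u = some w := hf.comm u v ▸ h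
  have h2 := hf.invol _ _ _ h
  have h3 := hf.invol _ _ _ h1
  have h4 : f w u = some v := hf.comm u w ▸ h2
  have h5 : f w v = some u := hf.comm v w ▸ h3
  simp only [Finset.mem_insert, Finset.mem_singleton] at ha hb
  rcases ha with rfl | rfl | rfl <;> rcases hb with rfl | rfl | rfl <;>
    first
    | exact absurd rfl hab
    | exact ⟨_, by assumption, by grind⟩

theorem IsSteinerOp.isLinear_lines {f : V → V → Option V} (hf : IsSteinerOp f) :
    IsLinear (lines f) := by
  refine ⟨fun T hT => ?_, fun S hS T hT hST => ?_⟩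
  · obtain ⟨u, v, w, h, rfl⟩ := mem_lines.1 hT
    have := hf.ne h
    exact Finset.card_eq_three.2 ⟨u, v, w, this.1, this.2.1, this.2.2, rfl⟩
  · by_contra! h
    obtain ⟨a, ha, b, hb, hab⟩ := Finset.one_lt_card.1 h
    rw [Finset.mem_inter] at ha hb
    obtain ⟨c, hc, rfl⟩ := hf.eq_of_mem_lines hS hab ha.1 hb.1
    obtain ⟨c', hc', rfl⟩ := hf.eq_of_mem_lines hT hab ha.2 hb.2
    rw [hc] at hc'
    simp_all

theorem IsSteinerOp.isSpreading_lines {f : V → V → Option V} (hf : IsSteinerOp f)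
    (hsp : IsSpreadingOp f) : IsSpreading (lines f) := by
  intro W hW
  obtain ⟨hWU, hU⟩ := (isLeast_closure (lines f) (W : Set V)).1
  set U := closure (lines f) (W : Set V)
  have hcl : ∀ u ∈ U, ∀ v ∈ U, ∀ w, f u v = some w → w ∈ U := by
    intro u hu v hv w h
    by_contra hw
    have hT : ({u, v, w} : Finset V) ∈ lines f := mem_lines.2 ⟨u, v, w, h, rfl⟩
    have : w ∈ neighbours (lines f) U :=
      ⟨hw, u, hu, v, hv, ⟨(hf.ne h).1, _, hT, by simp, by simp⟩, hT⟩
    rw [hU] at this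
    exact this
  obtain ⟨x, y, z, hx, hy, hz, hxy, hxz, hyz⟩ := Finset.two_lt_card_iff.1 hW.1
  by_cases h : f x y = some z
  -- When the chosen three points are collinear, `W` has a further point `a`, and `x, y, a` are not
  -- collinear.
  · have hne : W ≠ {x, y, z} := fun e => hW.2 (mem_lines.2 ⟨x, y, z, h, e⟩)
    have hsub : ({x, y, z} : Finset V) ⊆ W := by
      intro a ha
      simp only [Finset.mem_insert, Finset.mem_singleton] at ha
      rcases ha with rfl | rfl | rfl <;> assumption
    obtain ⟨a, ha, ha'⟩ := Finset.exists_of_ssubset (hsub.ssubset_of_ne hne.symm)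
    simp only [Finset.mem_insert, Finset.mem_singleton, not_or] at ha'
    refine hsp U hcl x (hWU hx) y (hWU hy) a (hWU ha) hxy (Ne.symm ha'.1) (Ne.symm ha'.2.1) ?_
    rw [h]
    simpa using Ne.symm ha'.2.2
  · exact hsp U hcl x (hWU hx) y (hWU hy) z (hWU hz) hxy hxz hyz h

open Classical in
theorem IsSteinerOp.six_mul_card_lines {f : V → V → Option V} (hf : IsSteinerOp f) :
    6 * (lines f).card ≤ ∑ u, (Finset.univ.filter fun v => f u v ≠ none).card := by
  rw [hf.isLinear_lines.six_mul_card]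
  refine Finset.sum_le_sum fun u _ => ?_
  rw [← SimpleGraph.card_neighborFinset_eq_degree]
  refine Finset.card_le_card fun v hv => ?_
  obtain ⟨hne, T, hT, hu, hv⟩ := (SimpleGraph.mem_neighborFinset _ _ _).1 hv
  obtain ⟨c, hc, -⟩ := hf.eq_of_mem_lines hT hne hu hv
  simp [hc]

end Operation

open Classical in
theorem xiSp_le_of_op {V : Type*} [Fintype V] {f : V → V → Option V} (hf : IsSteinerOp f) (hsp : IsSpreadingOp f) :
    ∃ m : ℕ, xiSp (Fintype.card V) ≤ m ∧
      6 * m ≤ ∑ u, (Finset.univ.filter fun v => f u v ≠ none).card := by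
  set e := (Fintype.equivFin V).symm
  have hg := hf.conj e
  refine ⟨(lines (conjOp e f)).card,
    iInf₂_le _ ⟨hg.isLinear_lines, hg.isSpreading_lines (hsp.conj e)⟩,
    hg.six_mul_card_lines.trans (le_of_eq ?_)⟩
  refine Fintype.sum_equiv e _ _ fun u => ?_
  refine Finset.card_equiv e fun v => ?_
  simp [conjOp]

/-! ### The six-class construction -/

section Construction

/-- The three fixed-point-free matchings on the six classes. -/
def mate (k : Fin 3) (i : ZMod 6) : ZMod 6 :=
  if k = 2 then i + 3 else if (Even i.val ↔ k = 0) then i + 1 else i + 5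

/-- The matching that contains the pair of classes `i`, `j` of different parity. -/
def mateIndex (i j : ZMod 6) : Fin 3 :=
  if mate 0 i = j then 0 else if mate 1 i = j then 1 else 2

/-- The constant sum of the triples that meet class `i` and two more classes of its parity. -/
def classSum (p : ℕ) (i : ZMod 6) : ZMod p := if Even i.val then 0 else 1

variable {p : ℕ}

theorem class_cases (i j : ZMod 6) :
    j = i ∨ j = i + 1 ∨ j = i + 2 ∨ j = i + 3 ∨ j = i + 4 ∨ j = i + 5 := by
  revert i j; decide

theorem mate_ne (k : Fin 3) (i : ZMod 6) :
    mate k i ≠ i ∧ mate k i ≠ i + 2 ∧ mate k i ≠ i + 4 := by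
  revert k i; decide

theorem mateIndex_mate (k : Fin 3) (i : ZMod 6) : mateIndex i (mate k i) = k := by
  revert k i; decide

theorem mate_mate (k : Fin 3) (i : ZMod 6) : mate k (mate k i) = i := by
  revert k i; decide

theorem mate_mateIndex (i : ZMod 6) : mate (mateIndex i (i + 1)) i = i + 1 ∧
    mate (mateIndex i (i + 3)) i = i + 3 ∧ mate (mateIndex i (i + 5)) i = i + 5 := by
  revert i; decide

theorem pointOp_cases (a b : ZMod 6 × ZMod p) :
    (a = b) ∨ (∃ i x y, x ≠ y ∧ a = (i, x) ∧ b = (i, y)) ∨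
    (∃ i x y, a = (i, x) ∧ b = (i + 2, y)) ∨ (∃ i x y, a = (i, x) ∧ b = (i + 4, y)) ∨
    (∃ k i x, a = (i, x) ∧ b = (mate k i, x)) ∨
    (∃ i x y, x ≠ y ∧ a = (i, x) ∧ b = (i + 1, y)) ∨
    (∃ i x y, x ≠ y ∧ a = (i, x) ∧ b = (i + 5, y)) ∨
    (∃ i x y, x ≠ y ∧ a = (i, x) ∧ b = (i + 3, y)) := by
  obtain ⟨i, x⟩ := a
  obtain ⟨j, y⟩ := b
  obtain ⟨h1, h3, h5⟩ := mate_mateIndex i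
  by_cases hxy : x = y
  · subst hxy
    rcases class_cases i j with rfl | rfl | rfl | rfl | rfl | rfl
    · exact .inl rfl
    · exact .inr (.inr (.inr (.inr (.inl ⟨mateIndex i (i + 1), i, x, rfl, by rw [h1]⟩))))
    · exact .inr (.inr (.inl ⟨i, x, x, rfl, rfl⟩))
    · exact .inr (.inr (.inr (.inr (.inl ⟨mateIndex i (i + 3), i, x, rfl, by rw [h3]⟩))))
    · exact .inr (.inr (.inr (.inl ⟨i, x, x, rfl, rfl⟩)))
    · exact .inr (.inr (.inr (.inr (.inl ⟨mateIndex i (i + 5), i, x, rfl, by rw [h5]⟩))))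
  · rcases class_cases i j with rfl | rfl | rfl | rfl | rfl | rfl
    · exact .inr (.inl ⟨_, x, y, hxy, rfl, rfl⟩)
    · exact .inr (.inr (.inr (.inr (.inr (.inl ⟨i, x, y, hxy, rfl, rfl⟩)))))
    · exact .inr (.inr (.inl ⟨i, x, y, rfl, rfl⟩))
    · exact .inr (.inr (.inr (.inr (.inr (.inr (.inr ⟨i, x, y, hxy, rfl, rfl⟩))))))
    · exact .inr (.inr (.inr (.inl ⟨i, x, y, rfl, rfl⟩)))
    · exact .inr (.inr (.inr (.inr (.inr (.inr (.inl ⟨i, x, y, hxy, rfl, rfl⟩))))))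

theorem classSum_add_two (i : ZMod 6) : classSum p (i + 2) = classSum p i := by
  have : Even (i + 2).val ↔ Even i.val := by revert i; decide
  simp [classSum, this]

theorem classSum_add_four (i : ZMod 6) : classSum p (i + 4) = classSum p i := by
  have : Even (i + 4).val ↔ Even i.val := by revert i; decide
  simp [classSum, this]

variable [Fact p.Prime]

/-- The third point on the line through two points of the classes. -/
def pointOp (a b : ZMod 6 × ZMod p) : Option ((ZMod 6 × ZMod p) ⊕ Fin 3) :=
  if b.1 = a.1 then if a.2 = b.2 then none else some (.inl (a.1 + 1, (a.2 + b.2) / 2))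
  else if b.1 = a.1 + 2 ∨ b.1 = a.1 + 4 then
    some (.inl (2 * a.1 - b.1, classSum p a.1 - a.2 - b.2))
  else if a.2 = b.2 then some (.inr (mateIndex a.1 b.1))
  else if b.1 = a.1 + 1 then some (.inl (a.1, 2 * b.2 - a.2))
  else if a.1 = b.1 + 1 then some (.inl (b.1, 2 * a.2 - b.2))
  else none

/-- The third point on the line through two points, on six classes of size `p` and three
further points. -/
def sixOp : (ZMod 6 × ZMod p) ⊕ Fin 3 → (ZMod 6 × ZMod p) ⊕ Fin 3 →
    Option ((ZMod 6 × ZMod p) ⊕ Fin 3)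
  | .inl a, .inl b => pointOp a b
  | .inl a, .inr k => some (.inl (mate k a.1, a.2))
  | .inr k, .inl a => some (.inl (mate k a.1, a.2))
  | .inr k, .inr l => if k = l then none else some (.inr (-(k + l)))

theorem pointOp_same (i : ZMod 6) {x y : ZMod p} (h : x ≠ y) :
    pointOp (i, x) (i, y) = some (.inl (i + 1, (x + y) / 2)) := by
  simp [pointOp, h]

theorem pointOp_two (i : ZMod 6) (x y : ZMod p) :
    pointOp (i, x) (i + 2, y) = some (.inl (i + 4, classSum p i - x - y)) := by
  have h1 : i + 2 ≠ i := by revert i; decide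
  have h2 : 2 * i - (i + 2) = i + 4 := by revert i; decide
  simp [pointOp, h1, h2]

theorem pointOp_four (i : ZMod 6) (x y : ZMod p) :
    pointOp (i, x) (i + 4, y) = some (.inl (i + 2, classSum p i - x - y)) := by
  have h1 : i + 4 ≠ i := by revert i; decide
  have h2 : 2 * i - (i + 4) = i + 2 := by revert i; decide
  simp [pointOp, h1, h2]

/-- Here `y` is the midpoint, so the third point is the reflection of `x` in `y`. -/
theorem pointOp_one (i : ZMod 6) {x y : ZMod p} (h : x ≠ y) :
    pointOp (i, x) (i + 1, y) = some (.inl (i, 2 * y - x)) := by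
  have h1 : i + 1 ≠ i := by revert i; decide
  have h2 : ¬ (i + 1 = i + 2 ∨ i + 1 = i + 4) := by revert i; decide
  simp only [pointOp, h, h1, h2, if_true, if_false]

theorem pointOp_five (i : ZMod 6) {x y : ZMod p} (h : x ≠ y) :
    pointOp (i, x) (i + 5, y) = some (.inl (i + 5, 2 * x - y)) := by
  have h1 : i + 5 ≠ i := by revert i; decide
  have h2 : ¬ (i + 5 = i + 2 ∨ i + 5 = i + 4) := by revert i; decide
  have h3 : i + 5 ≠ i + 1 := by revert i; decide
  have h4 : i = i + 5 + 1 := by revert i; decide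
  simp only [pointOp, h, h1, h2, h3, ← h4, if_true, if_false]

theorem pointOp_three (i : ZMod 6) {x y : ZMod p} (h : x ≠ y) :
    pointOp (i, x) (i + 3, y) = none := by
  have h1 : i + 3 ≠ i := by revert i; decide
  have h2 : ¬ (i + 3 = i + 2 ∨ i + 3 = i + 4) := by revert i; decide
  have h3 : i + 3 ≠ i + 1 := by revert i; decide
  have h4 : i ≠ i + 3 + 1 := by revert i; decide
  simp only [pointOp, h, h1, h2, h3, h4, if_false]

theorem pointOp_mate (k : Fin 3) (i : ZMod 6) (x : ZMod p) :
    pointOp (i, x) (mate k i, x) = some (.inr k) := by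
  obtain ⟨h1, h2, h3⟩ := mate_ne k i
  simp [pointOp, h1, h2, h3, mateIndex_mate]

theorem pointOp_comm (a b : ZMod 6 × ZMod p) : pointOp a b = pointOp b a := by
  have e1 : ∀ i : ZMod 6, i = i + 1 + 5 := by decide
  have e2 : ∀ i : ZMod 6, i = i + 2 + 4 := by decide
  have e3 : ∀ i : ZMod 6, i = i + 3 + 3 := by decide
  have e4 : ∀ i : ZMod 6, i = i + 4 + 2 := by decide
  have e5 : ∀ i : ZMod 6, i = i + 5 + 1 := by decide
  have e6 : ∀ i : ZMod 6, i + 2 + 2 = i + 4 := by decide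
  have e7 : ∀ i : ZMod 6, i + 4 + 4 = i + 2 := by decide
  rcases pointOp_cases a b with rfl | ⟨i, x, y, h, rfl, rfl⟩ | ⟨i, x, y, rfl, rfl⟩ |
    ⟨i, x, y, rfl, rfl⟩ | ⟨k, i, x, rfl, rfl⟩ | ⟨i, x, y, h, rfl, rfl⟩ | ⟨i, x, y, h, rfl, rfl⟩ |
    ⟨i, x, y, h, rfl, rfl⟩
  · rfl
  · rw [pointOp_same i h, pointOp_same i h.symm, add_comm x y]
  · have := pointOp_four (i + 2) y x
    rw [← e2, e6, classSum_add_two] at this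
    rw [pointOp_two, this, sub_right_comm]
  · have := pointOp_two (i + 4) y x
    rw [← e4, e7, classSum_add_four] at this
    rw [pointOp_four, this, sub_right_comm]
  · have := pointOp_mate k (mate k i) x
    rw [mate_mate] at this
    rw [pointOp_mate, this]
  · have := pointOp_five (i + 1) h.symm
    rw [← e1] at this
    rw [pointOp_one i h, this]
  · have := pointOp_one (i + 5) h.symm
    rw [← e5] at this
    rw [pointOp_five i h, this]
  · have := pointOp_three (i + 3) h.symm
    rw [← e3] at this
    rw [pointOp_three i h, this]

theorem two_ne_zero_of_odd (hp : Odd p) : (2 : ZMod p) ≠ 0 := by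
  intro h
  have h2 : ((2 : ℕ) : ZMod p) = 0 := by exact_mod_cast h
  rw [ZMod.natCast_eq_zero_iff] at h2
  have := (Nat.prime_dvd_prime_iff_eq Fact.out Nat.prime_two).1 h2
  subst this
  exact absurd hp (by decide)

theorem isSteinerOp_sixOp (hp : Odd p) : IsSteinerOp (sixOp (p := p)) where
  irrefl := by
    rintro (⟨i, x⟩ | k) <;> simp [sixOp, pointOp]
  comm := by
    rintro (a | k) (b | l)
    · exact pointOp_comm a b
    · rfl
    · rfl
    · simp only [sixOp, eq_comm, add_comm]
  invol := by
    have h2 := two_ne_zero_of_odd hp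
    rintro (a | k) (b | l) w h
    · simp only [sixOp] at h
      rcases pointOp_cases a b with rfl | ⟨i, x, y, hxy, rfl, rfl⟩ | ⟨i, x, y, rfl, rfl⟩ |
        ⟨i, x, y, rfl, rfl⟩ | ⟨k, i, x, rfl, rfl⟩ | ⟨i, x, y, hxy, rfl, rfl⟩ |
        ⟨i, x, y, hxy, rfl, rfl⟩ | ⟨i, x, y, hxy, rfl, rfl⟩
      · simp [pointOp] at h
      · rw [pointOp_same i hxy] at h
        cases h
        have : x ≠ (x + y) / 2 := by
          intro h
          field_simp at h
          exact hxy (by linear_combination h)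
        simp only [sixOp, pointOp_one i this]
        congr 3
        field_simp
        ring
      · rw [pointOp_two] at h
        cases h
        simp [sixOp, pointOp_four]
      · rw [pointOp_four] at h
        cases h
        simp [sixOp, pointOp_two]
      · rw [pointOp_mate] at h
        cases h
        simp [sixOp]
      · rw [pointOp_one i hxy] at h
        cases h
        have : x ≠ 2 * y - x := by
          intro h
          have : 2 * (x - y) = 0 := by linear_combination h
          exact hxy (sub_eq_zero.1 ((mul_eq_zero.1 this).resolve_left h2))
        have e : (x + (2 * y - x)) / 2 = y := by
          field_simp
          ring
        simp only [sixOp, pointOp_same i this, e]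
      · rw [pointOp_five i hxy] at h
        cases h
        have : x ≠ 2 * x - y := by
          intro h
          exact hxy (by linear_combination -h)
        simp only [sixOp, pointOp_five i this]
        congr 3
        ring
      · rw [pointOp_three i hxy] at h
        cases h
    · cases h
      exact pointOp_mate l a.1 a.2
    · cases h
      simp [sixOp, mate_mate]
    · have key : ∀ k l : Fin 3, k ≠ l → k ≠ -(k + l) ∧ -(k + -(k + l)) = l := by decide
      simp only [sixOp] at h
      split_ifs at h with hkl
      cases h
      obtain ⟨h1, h3⟩ := key k l hkl
      simp only [sixOp, h1, h3, if_false]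

end Construction

/-! ### Closed sets of the construction -/

section Spreading

variable {p : ℕ} [Fact p.Prime]

/-- As `p` is prime, the multiples of `t` exhaust `ZMod p`. -/
theorem forall_of_add_mem {S : Set (ZMod p)} {t x₀ : ZMod p} (ht : t ≠ 0) (hx₀ : x₀ ∈ S)
    (h : ∀ x ∈ S, x + t ∈ S) (y : ZMod p) : y ∈ S := by
  have key : ∀ n : ℕ, x₀ + n * t ∈ S := by
    intro n
    induction n with
    | zero => simpa using hx₀
    | succ n ih =>
      have := h _ ih
      push_cast
      rwa [add_mul, one_mul, ← add_assoc]
  have := key ((y - x₀) / t).val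
  rwa [ZMod.natCast_zmod_val, div_mul_cancel₀ _ ht, add_sub_cancel] at this

theorem IsSteinerOp.eq_some_of_cover {V : Type*} {f : V → V → Option V} (hf : IsSteinerOp f)
    {U : Set V} {P Q R : V} (hline : f P Q = some R) (hcov : ∀ u ∈ U, u = P ∨ u = Q ∨ u = R)
    {x y z : V} (hx : x ∈ U) (hy : y ∈ U) (hz : z ∈ U) (hxy : x ≠ y) (hxz : x ≠ z)
    (hyz : y ≠ z) : f x y = some z := by
  have h1 : f Q P = some R := hf.comm P Q ▸ hline
  have h2 := hf.invol _ _ _ hline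
  have h3 := hf.invol _ _ _ h1
  have h4 : f R P = some Q := hf.comm P R ▸ h2
  have h5 : f R Q = some P := hf.comm Q R ▸ h3
  rcases hcov x hx with rfl | rfl | rfl <;> rcases hcov y hy with rfl | rfl | rfl <;>
    rcases hcov z hz with rfl | rfl | rfl <;> first | assumption | contradiction

/-- A proper subset of the points that is closed under the operation. -/
structure IsProperClosed (U : Set ((ZMod 6 × ZMod p) ⊕ Fin 3)) : Prop where
  closed : ∀ u ∈ U, ∀ v ∈ U, ∀ w, sixOp u v = some w → w ∈ U
  ne : U ≠ Set.univ
  odd : Odd p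

namespace IsProperClosed

variable {U : Set ((ZMod 6 × ZMod p) ⊕ Fin 3)} (hU : IsProperClosed U)
include hU

theorem reflect {i : ZMod 6} {x z : ZMod p} (hx : .inl (i, x) ∈ U) (hz : .inl (i + 1, z) ∈ U) :
    .inl (i, 2 * z - x) ∈ U := by
  by_cases h : x = z
  · subst h
    rwa [two_mul, add_sub_cancel_right]
  · exact hU.closed _ hx _ hz _ (pointOp_one i h)

theorem midpoint {i : ZMod 6} {x y : ZMod p} (hx : .inl (i, x) ∈ U) (hy : .inl (i, y) ∈ U)
    (h : x ≠ y) : .inl (i + 1, (x + y) / 2) ∈ U :=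
  hU.closed _ hx _ hy _ (pointOp_same i h)

theorem add_four {i : ZMod 6} {x y : ZMod p} (hx : .inl (i, x) ∈ U) (hy : .inl (i + 2, y) ∈ U) :
    .inl (i + 4, classSum p i - x - y) ∈ U :=
  hU.closed _ hx _ hy _ (pointOp_two i x y)

theorem add_two {i : ZMod 6} {x y : ZMod p} (hx : .inl (i, x) ∈ U) (hy : .inl (i + 4, y) ∈ U) :
    .inl (i + 2, classSum p i - x - y) ∈ U :=
  hU.closed _ hx _ hy _ (pointOp_four i x y)

theorem mate_mem {k : Fin 3} {i : ZMod 6} {x : ZMod p} (hk : .inr k ∈ U)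
    (hx : .inl (i, x) ∈ U) : .inl (mate k i, x) ∈ U :=
  hU.closed _ hk _ hx _ rfl

theorem mem_of_mate {k : Fin 3} {i : ZMod 6} {x : ZMod p} (hx : .inl (i, x) ∈ U)
    (hy : .inl (mate k i, x) ∈ U) : .inr k ∈ U :=
  hU.closed _ hx _ hy _ (pointOp_mate k i x)

/-- Every element is the midpoint of two distinct ones, so a full class fills the next and,
cyclically, all six; matched points then give the points at infinity. -/
theorem not_full (i : ZMod 6) : ¬ ∀ x : ZMod p, .inl (i, x) ∈ U := by
  intro h
  have h2 := two_ne_zero_of_odd hU.odd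
  have step : ∀ j : ZMod 6, (∀ x : ZMod p, .inl (j, x) ∈ U) → ∀ x : ZMod p, .inl (j + 1, x) ∈ U := by
    intro j hj x
    have hne : x - 1 ≠ x + 1 := fun e => h2 (by linear_combination -e)
    have := hU.midpoint (hj (x - 1)) (hj (x + 1)) hne
    have e : (x - 1 + (x + 1)) / 2 = x := by
      field_simp
      ring
    rwa [e] at this
  have h1 := step _ h
  have h2 := step _ h1
  have h3 := step _ h2
  have h4 := step _ h3
  have h5 := step _ h4
  have hall : ∀ (j : ZMod 6) (x : ZMod p), .inl (j, x) ∈ U := by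
    intro j
    have key : j = i ∨ j = i + 1 ∨ j = i + 1 + 1 ∨ j = i + 1 + 1 + 1 ∨ j = i + 1 + 1 + 1 + 1 ∨
        j = i + 1 + 1 + 1 + 1 + 1 := by
      clear * -
      revert i j; decide
    rcases key with rfl | rfl | rfl | rfl | rfl | rfl <;> assumption
  refine hU.ne (Set.eq_univ_of_forall ?_)
  rintro (⟨j, x⟩ | k)
  · exact hall j x
  · exact hU.mem_of_mate (hall 0 0) (hall _ 0)

/-- The reflections of class `i` in `z` and `z'` compose to translation by `2 * (z' - z)`. -/
theorem eq_of_mem_add_one {i : ZMod 6} {x z z' : ZMod p} (hx : .inl (i, x) ∈ U)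
    (hz : .inl (i + 1, z) ∈ U) (hz' : .inl (i + 1, z') ∈ U) : z = z' := by
  by_contra hne
  refine hU.not_full i (forall_of_add_mem (S := {x | .inl (i, x) ∈ U}) (t := 2 * (z' - z))
    (mul_ne_zero (two_ne_zero_of_odd hU.odd) (sub_ne_zero.2 (Ne.symm hne))) hx ?_)
  intro y hy
  have := hU.reflect (hU.reflect hy hz) hz'
  have e : 2 * z' - (2 * z - y) = y + 2 * (z' - z) := by ring
  rwa [e] at this

/-- A third point would give two different midpoints in class `i + 1`. -/
theorem eq_or_eq {i : ZMod 6} {x y z : ZMod p} (hx : .inl (i, x) ∈ U) (hy : .inl (i, y) ∈ U)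
    (hz : .inl (i, z) ∈ U) (hxy : x ≠ y) : z = x ∨ z = y := by
  by_contra! h
  have := hU.eq_of_mem_add_one hx (hU.midpoint hx hy hxy) (hU.midpoint hx hz h.1.symm)
  have h2 := two_ne_zero_of_odd hU.odd
  field_simp at this
  exact h.2 (by linear_combination -this)

/-- Going from class `i + 2` to `i + 4` through `x` and back through `x'` is translation by `x -
x'`. -/
theorem eq_of_mem_add_two {i : ZMod 6} {x x' y : ZMod p} (hx : .inl (i, x) ∈ U)
    (hx' : .inl (i, x') ∈ U) (hy : .inl (i + 2, y) ∈ U) : x = x' := by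
  by_contra hne
  refine hU.not_full (i + 2) (forall_of_add_mem (S := {x | .inl (i + 2, x) ∈ U}) (t := x - x')
    (sub_ne_zero.2 hne) hy ?_)
  intro b hb
  have := hU.add_two hx' (hU.add_four hx hb)
  have e : classSum p i - x' - (classSum p i - x - b) = b + (x - x') := by ring
  rwa [e] at this

theorem eq_of_mem_add_four {i : ZMod 6} {x x' y : ZMod p} (hx : .inl (i, x) ∈ U)
    (hx' : .inl (i, x') ∈ U) (hy : .inl (i + 4, y) ∈ U) : x = x' :=
  hU.eq_of_mem_add_two hx hx' (hU.add_two hx hy)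

/-- The translation lemmas empty all classes except `i` and `i + 1`; a point at infinity would copy
both `x` and `y` into class `i + 1` or into an empty class. Only the line through the two points and
their midpoint remains. -/
theorem sixOp_eq_some_of_two_mem {i : ZMod 6} {x y : ZMod p} (hx : .inl (i, x) ∈ U)
    (hy : .inl (i, y) ∈ U) (hxy : x ≠ y) {a b c : (ZMod 6 × ZMod p) ⊕ Fin 3}
    (ha : a ∈ U) (hb : b ∈ U) (hc : c ∈ U) (hab : a ≠ b) (hac : a ≠ c) (hbc : b ≠ c) :
    sixOp a b = some c := by
  have hm := hU.midpoint hx hy hxy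
  have h5 : ∀ w : ZMod p, .inl (i + 5, w) ∉ U := by
    intro w hw
    have e : i + 5 + 1 = i := by clear * -; revert i; decide
    exact hxy (hU.eq_of_mem_add_one hw (by rwa [e]) (by rwa [e]))
  have h3 : ∀ w : ZMod p, .inl (i + 3, w) ∉ U := by
    intro w hw
    have e : i + 1 + 2 = i + 3 := by ring
    have e' : i + 1 + 4 = i + 5 := by ring
    have := hU.add_four hm (e ▸ hw)
    rw [e'] at this
    exact h5 _ this
  refine (isSteinerOp_sixOp hU.odd).eq_some_of_cover (U := U) (P := .inl (i, x))
    (Q := .inl (i, y)) (R := .inl (i + 1, (x + y) / 2)) (pointOp_same i hxy) ?_ ha hb hc hab hac hbc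
  rintro (⟨j, w⟩ | k) hw
  · rcases class_cases i j with rfl | rfl | rfl | rfl | rfl | rfl
    · rcases hU.eq_or_eq hx hy hw hxy with rfl | rfl <;> simp
    · rw [hU.eq_of_mem_add_one hx hw hm]
      simp
    · exact absurd (hU.eq_of_mem_add_two hx hy hw) hxy
    · exact absurd hw (h3 w)
    · exact absurd (hU.eq_of_mem_add_four hx hy hw) hxy
    · exact absurd hw (h5 w)
  · have hx' := hU.mate_mem hw hx
    have hy' := hU.mate_mem hw hy
    have key : mate k i = i + 1 ∨ mate k i = i + 3 ∨ mate k i = i + 5 := by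
      clear * -
      revert k i; decide
    rcases key with e | e | e <;> rw [e] at hx' hy'
    · exact absurd (hU.eq_of_mem_add_one hx hx' hy') hxy
    · exact absurd hx' (h3 x)
    · exact absurd hx' (h5 x)

/-! ### Proper closed sets with at most one point in each class -/

section Thin

variable (hthin : ∀ (i : ZMod 6) (x y : ZMod p), .inl (i, x) ∈ U → .inl (i, y) ∈ U → x = y)
include hthin

/-- The reflection of `x` in `z` lies in the same class, hence equals `x`. -/
theorem eq_of_thin {i : ZMod 6} {x z : ZMod p} (hx : .inl (i, x) ∈ U)
    (hz : .inl (i + 1, z) ∈ U) : x = z := by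
  have := hthin _ _ _ hx (hU.reflect hx hz)
  have h2 := two_ne_zero_of_odd hU.odd
  exact mul_left_cancel₀ h2 (by linear_combination this)

/-- Otherwise all six coordinates agree, and the even and odd sums make three times their value both
0 and 1. -/
theorem exists_class_empty : ∃ i, ∀ x : ZMod p, .inl (i, x) ∉ U := by
  by_contra! h
  choose a ha using h
  have step : ∀ i, a i = a (i + 1) := fun i => hU.eq_of_thin hthin (ha i) (ha (i + 1))
  have e1 := step 0
  have e2 := step (0 + 1)
  have e3 := step (0 + 1 + 1)
  have e4 := step (0 + 1 + 1 + 1)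
  have e5 := step (0 + 1 + 1 + 1 + 1)
  have f0 := hthin _ _ _ (hU.add_four (ha 0) (ha (0 + 2))) (ha _)
  have f1 := hthin _ _ _ (hU.add_four (ha 1) (ha (1 + 2))) (ha _)
  have c0 : classSum p 0 = 0 := by simp [classSum]
  have c1 : classSum p 1 = 1 := by
    have : ¬ Even (1 : ZMod 6).val := by decide
    simp [classSum, this]
  rw [c0, show (0 + 2 : ZMod 6) = 0 + 1 + 1 by decide,
    show (0 + 4 : ZMod 6) = 0 + 1 + 1 + 1 + 1 by decide] at f0
  rw [c1, show (1 + 2 : ZMod 6) = 0 + 1 + 1 + 1 by decide,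
    show (1 + 4 : ZMod 6) = 0 + 1 + 1 + 1 + 1 + 1 by decide,
    show a 1 = a (0 + 1) from congrArg a (by decide)] at f1
  have s0 : 3 * a 0 = 0 := by linear_combination -f0 + 2 * e1 + 2 * e2 + e3 + e4
  have s1 : 3 * a 0 = 1 := by linear_combination -f1 + 3 * e1 + 2 * e2 + 2 * e3 + e4 + e5
  exact one_ne_zero (s1.symm.trans s0)

/-- All three classes of one parity are met. A point at infinity would carry them onto the other
three, leaving no class empty; a point of the other parity would share its coordinate with a
neighbour and so produce a point at infinity. -/
theorem sixOp_eq_some_of_add_two {i : ZMod 6} {x y : ZMod p} (hx : .inl (i, x) ∈ U)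
    (hy : .inl (i + 2, y) ∈ U) {a b c : (ZMod 6 × ZMod p) ⊕ Fin 3}
    (ha : a ∈ U) (hb : b ∈ U) (hc : c ∈ U) (hab : a ≠ b) (hac : a ≠ c) (hbc : b ≠ c) :
    sixOp a b = some c := by
  have hz := hU.add_four hx hy
  have hinf : ∀ k : Fin 3, .inr k ∉ U := by
    intro k hk
    obtain ⟨j, hj⟩ := hU.exists_class_empty hthin
    have key : j = i ∨ j = i + 2 ∨ j = i + 4 ∨ j = mate k i ∨ j = mate k (i + 2) ∨
        j = mate k (i + 4) := by
      clear * -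
      revert k i j; decide
    rcases key with rfl | rfl | rfl | rfl | rfl | rfl
    · exact hj _ hx
    · exact hj _ hy
    · exact hj _ hz
    · exact hj _ (hU.mate_mem hk hx)
    · exact hj _ (hU.mate_mem hk hy)
    · exact hj _ (hU.mate_mem hk hz)
  have hodd : ∀ (j : ZMod 6) (w w' : ZMod p), .inl (j, w) ∈ U → .inl (j + 1, w') ∉ U := by
    intro j w w' hw hw'
    have := hU.eq_of_thin hthin hw hw'
    subst this
    exact hinf (mateIndex j (j + 1)) (hU.mem_of_mate hw (by rwa [(mate_mateIndex j).1]))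
  refine (isSteinerOp_sixOp hU.odd).eq_some_of_cover (U := U) (P := .inl (i, x))
    (Q := .inl (i + 2, y)) (R := .inl (i + 4, classSum p i - x - y)) (pointOp_two i x y) ?_
    ha hb hc hab hac hbc
  rintro (⟨j, w⟩ | k) hw
  · rcases class_cases i j with rfl | rfl | rfl | rfl | rfl | rfl
    · rw [hthin _ _ _ hw hx]
      simp
    · exact absurd hw (hodd _ _ _ hx)
    · rw [hthin _ _ _ hw hy]
      simp
    · exact absurd hw (by
        have := hodd _ _ w hy
        rwa [add_assoc, two_add_one_eq_three] at this)
    · rw [hthin _ _ _ hw hz]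
      simp
    · exact absurd hw (by
        have := hodd _ _ w hz
        rwa [add_assoc, show (4 + 1 : ZMod 6) = 5 by decide] at this)
  · exact absurd hw (hinf k)

variable (htwo : ∀ (i : ZMod 6) (x y : ZMod p), .inl (i, x) ∈ U → .inl (i + 2, y) ∉ U)
include htwo

theorem eq_of_not_add_odd {i j : ZMod 6} {x y : ZMod p} (hx : .inl (i, x) ∈ U)
    (hy : .inl (j, y) ∈ U) (hij : j = i ∨ j = i + 2 ∨ j = i + 4) : j = i ∧ y = x := by
  rcases hij with rfl | rfl | rfl
  · exact ⟨rfl, hthin _ _ _ hy hx⟩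
  · exact absurd hy (htwo _ _ _ hx)
  · have e : i + 4 + 2 = i := by clear * -; revert i; decide
    exact absurd hx (by simpa [e] using htwo _ _ x hy)

theorem sixOp_eq_inr {a b : ZMod 6 × ZMod p} {k : Fin 3} (ha : .inl a ∈ U) (hb : .inl b ∈ U)
    (hk : .inr k ∈ U) (hab : a ≠ b) : sixOp (.inl a) (.inl b) = some (.inr k) := by
  obtain ⟨i, x⟩ := a
  obtain ⟨j, y⟩ := b
  have key : (j = i ∨ j = i + 2 ∨ j = i + 4) ∨
      (j = mate k i ∨ j = mate k i + 2 ∨ j = mate k i + 4) := by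
    clear * -
    revert i j k; decide
  rcases key with h | h
  · obtain ⟨rfl, rfl⟩ := hU.eq_of_not_add_odd hthin htwo ha hb h
    exact absurd rfl hab
  · obtain ⟨rfl, rfl⟩ := hU.eq_of_not_add_odd hthin htwo (hU.mate_mem hk ha) hb h
    exact pointOp_mate k i y

/-- Two points at infinity would send `a` to different classes of the same parity. -/
theorem eq_of_inr_mem {a : ZMod 6 × ZMod p} {k l : Fin 3} (ha : .inl a ∈ U)
    (hk : .inr k ∈ U) (hl : .inr l ∈ U) : k = l := by
  obtain ⟨i, x⟩ := a
  have key : mate l i = mate k i ∨ mate l i = mate k i + 2 ∨ mate l i = mate k i + 4 := by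
    clear * -
    revert i k l; decide
  have := (hU.eq_of_not_add_odd hthin htwo (hU.mate_mem hk ha) (hU.mate_mem hl ha) key).1
  rw [← mateIndex_mate k i, ← this, mateIndex_mate]

theorem sixOp_eq_some_of_thin {a b c : (ZMod 6 × ZMod p) ⊕ Fin 3}
    (ha : a ∈ U) (hb : b ∈ U) (hc : c ∈ U) (hab : a ≠ b) (hac : a ≠ c) (hbc : b ≠ c) :
    sixOp a b = some c := by
  have hS := isSteinerOp_sixOp hU.odd
  rcases a with ⟨i, x⟩ | k <;> rcases b with ⟨j, y⟩ | l <;> rcases c with ⟨m, z⟩ | r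
  -- Pigeonhole: two of three classes have the same parity, yet each parity holds at most one point.
  · have key : (j = i ∨ j = i + 2 ∨ j = i + 4) ∨ (m = i ∨ m = i + 2 ∨ m = i + 4) ∨
        (m = j ∨ m = j + 2 ∨ m = j + 4) := by
      clear * -
      revert i j m; decide
    rcases key with h | h | h
    · obtain ⟨rfl, rfl⟩ := hU.eq_of_not_add_odd hthin htwo ha hb h
      contradiction
    · obtain ⟨rfl, rfl⟩ := hU.eq_of_not_add_odd hthin htwo ha hc h
      contradiction
    · obtain ⟨rfl, rfl⟩ := hU.eq_of_not_add_odd hthin htwo hb hc h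
      contradiction
  · exact hU.sixOp_eq_inr hthin htwo ha hb hc (by rintro h; exact hab (congrArg _ h))
  · exact hS.invol _ _ _ (hU.sixOp_eq_inr hthin htwo ha hc hb (by rintro h; exact hac (congrArg _ h)))
  · exact absurd (congrArg _ (hU.eq_of_inr_mem hthin htwo ha hb hc)) hbc
  · rw [hS.comm]
    exact hS.invol _ _ _ (hU.sixOp_eq_inr hthin htwo hb hc ha (by rintro h; exact hbc (congrArg _ h)))
  · exact absurd (congrArg _ (hU.eq_of_inr_mem hthin htwo hb ha hc)) hac
  · exact absurd (congrArg _ (hU.eq_of_inr_mem hthin htwo hc ha hb)) hab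
  · have key : ∀ k l r : Fin 3, k ≠ l → k ≠ r → l ≠ r → -(k + l) = r := by decide
    have hkl : k ≠ l := fun h => hab (congrArg _ h)
    simp [sixOp, hkl, key k l r hkl (fun h => hac (congrArg _ h)) (fun h => hbc (congrArg _ h))]

end Thin

end IsProperClosed

theorem isSpreadingOp_sixOp (hp : Odd p) : IsSpreadingOp (sixOp (p := p)) := by
  intro U hcl a ha b hb c hc hab hac hbc habc
  by_contra hne
  have hU : IsProperClosed U := ⟨hcl, hne, hp⟩
  have hthin : ∀ (i : ZMod 6) (x y : ZMod p), .inl (i, x) ∈ U → .inl (i, y) ∈ U → x = y := by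
    intro i x y hx hy
    by_contra h
    exact habc (hU.sixOp_eq_some_of_two_mem hx hy h ha hb hc hab hac hbc)
  have htwo : ∀ (i : ZMod 6) (x y : ZMod p), .inl (i, x) ∈ U → .inl (i + 2, y) ∉ U := by
    intro i x y hx hy
    exact habc (hU.sixOp_eq_some_of_add_two hthin hx hy ha hb hc hab hac hbc)
  exact habc (hU.sixOp_eq_some_of_thin hthin htwo ha hb hc hab hac hbc)

-- The excluded `p` points are the point itself and the `p - 1` points of the opposite class with
-- another coordinate.
open Classical in
theorem card_filter_sixOp_le (i : ZMod 6) (x : ZMod p) :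
    (Finset.univ.filter fun v => sixOp (.inl (i, x)) v ≠ none).card ≤ 5 * p + 3 := by
  have hpt : ∀ y : ZMod p, y ≠ x → sixOp (.inl (i, x)) (.inl (i + 3, y)) = none :=
    fun y h => pointOp_three i h.symm
  have hself : sixOp (.inl (i, x)) (.inl (i, x)) = none := by simp [sixOp, pointOp]
  set N : Finset ((ZMod 6 × ZMod p) ⊕ Fin 3) := insert (.inl (i, x))
    ((Finset.univ.erase x).image fun y => .inl (i + 3, y)) with hN
  have hNc : N.card = p := by
    have h3 : i ≠ i + 3 := by clear * -; revert i; decide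
    rw [hN, Finset.card_insert_of_notMem (by simp [h3.symm]), Finset.card_image_of_injective,
      Finset.card_erase_of_mem (Finset.mem_univ _), Finset.card_univ, ZMod.card]
    · exact Nat.sub_add_cancel (Nat.Prime.one_lt Fact.out).le
    · intro y y' h
      simpa using h
  have hdisj : Disjoint (Finset.univ.filter fun v => sixOp (.inl (i, x)) v ≠ none) N := by
    rw [Finset.disjoint_right]
    intro v hv
    rw [Finset.mem_filter, not_and, not_not]
    intro _
    rcases Finset.mem_insert.1 hv with rfl | hv
    · exact hself
    · obtain ⟨y, hy, rfl⟩ := Finset.mem_image.1 hv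
      exact hpt y (Finset.ne_of_mem_erase hy)
  have := Finset.card_le_univ ((Finset.univ.filter fun v => sixOp (.inl (i, x)) v ≠ none) ∪ N)
  rw [Finset.card_union_of_disjoint hdisj, hNc] at this
  simp only [Fintype.card_sum, Fintype.card_prod, ZMod.card, Fintype.card_fin] at this
  omega

theorem xiSp_six_mul_add_three_le (hp : Odd p) :
    ∃ m : ℕ, xiSp (6 * p + 3) ≤ m ∧ m ≤ 5 * p ^ 2 + 6 * p + 1 := by
  classical
  have hcard : Fintype.card ((ZMod 6 × ZMod p) ⊕ Fin 3) = 6 * p + 3 := by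
    simp [Fintype.card_sum, ZMod.card]
  obtain ⟨m, hm, hle⟩ := xiSp_le_of_op (isSteinerOp_sixOp hp) (isSpreadingOp_sixOp hp)
  rw [hcard] at hm
  refine ⟨m, hm, ?_⟩
  rw [Fintype.sum_sum_type] at hle
  have h1 : ∑ a : ZMod 6 × ZMod p, (Finset.univ.filter fun v => sixOp (.inl a) v ≠ none).card
      ≤ 6 * p * (5 * p + 3) := by
    refine (Finset.sum_le_card_nsmul _ _ (5 * p + 3) fun a _ => card_filter_sixOp_le a.1 a.2).trans
      (le_of_eq ?_)
    simp [ZMod.card]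
  have h2 : ∑ k : Fin 3, (Finset.univ.filter fun v : (ZMod 6 × ZMod p) ⊕ Fin 3 =>
      sixOp (.inr k) v ≠ none).card ≤ 3 * (6 * p + 2) := by
    refine (Finset.sum_le_card_nsmul _ _ (6 * p + 2) fun k _ => ?_).trans (le_of_eq ?_)
    · have : (Finset.univ.filter fun v : (ZMod 6 × ZMod p) ⊕ Fin 3 =>
          sixOp (.inr k) v ≠ none) ⊆ Finset.univ.erase (.inr k) := by
        intro v hv
        rw [Finset.mem_erase]
        refine ⟨?_, Finset.mem_univ _⟩
        rintro rfl
        simp [sixOp] at hv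
      have := Finset.card_le_card this
      rw [Finset.card_erase_of_mem (Finset.mem_univ _), Finset.card_univ, hcard] at this
      omega
    · simp
  have h3 : 6 * m ≤ 6 * p * (5 * p + 3) + 3 * (6 * p + 2) := hle.trans (Nat.add_le_add h1 h2)
  nlinarith

end Spreading

/-! ### Numerical conclusions -/

theorem lt_xiSp {n : ℕ} (hn : 300 ≤ n) :
    ENNReal.ofReal (0.1103 * (n : ℝ) ^ 2) < (xiSp n : ℝ≥0∞) := by
  have hle : ((⌈((n : ℝ) ^ 2 - 2 * n) / 9⌉₊ : ℕ) : ℕ∞) ≤ xiSp n := by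
    refine le_iInf₂ fun F hF => ?_
    have := hF.2.le_nine_mul_card hF.1 (by rw [Fintype.card_fin]; omega)
    rw [Fintype.card_fin] at this
    refine Nat.cast_le.2 (Nat.ceil_le.2 ?_)
    linarith
  have hle' : ((⌈((n : ℝ) ^ 2 - 2 * n) / 9⌉₊ : ℕ) : ℝ≥0∞) ≤ (xiSp n : ℝ≥0∞) := by
    exact_mod_cast hle
  refine lt_of_lt_of_le ?_ hle'
  rw [ENNReal.ofReal_lt_natCast (by
    intro h
    rw [Nat.ceil_eq_zero] at h
    have hn' : (300 : ℝ) ≤ n := by exact_mod_cast hn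
    nlinarith)]
  refine lt_of_lt_of_le ?_ (Nat.le_ceil _)
  have hn' : (300 : ℝ) ≤ n := by exact_mod_cast hn
  -- The inequality `0.1103 * n ^ 2 < (n ^ 2 - 2 * n) / 9` holds from about `n = 274` on.
  nlinarith

theorem xiSp_six_mul_add_three_lt {p : ℕ} (hp : p.Prime) (hodd : Odd p) :
    (xiSp (6 * p + 3) : ℝ≥0∞) <
      ENNReal.ofReal ((5 / 36 + 1 / ((6 * p + 3 : ℕ) : ℝ)) * ((6 * p + 3 : ℕ) : ℝ) ^ 2) := by
  have := Fact.mk hp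
  obtain ⟨m, hm, hmp⟩ := xiSp_six_mul_add_three_le hodd
  have hm' : (xiSp (6 * p + 3) : ℝ≥0∞) ≤ (m : ℝ≥0∞) := by exact_mod_cast hm
  refine lt_of_le_of_lt hm' ?_
  rw [ENNReal.natCast_lt_ofReal]
  have h1 : (m : ℝ) ≤ 5 * p ^ 2 + 6 * p + 1 := by exact_mod_cast hmp
  have h2 : (1 : ℝ) ≤ p := by exact_mod_cast hp.one_lt.le
  refine lt_of_le_of_lt h1 ?_
  push_cast
  have h3 : (6 * p + 3 : ℝ) ≠ 0 := by positivity
  have e : (5 / 36 + 1 / (6 * p + 3 : ℝ)) * (6 * p + 3) ^ 2 =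
      5 / 36 * (6 * p + 3) ^ 2 + (6 * p + 3) := by
    field_simp
  rw [e]
  nlinarith

end TripleSystem

theorem mainTheorem2 :
    (∀ᶠ n : ℕ in atTop,
      ENNReal.ofReal (0.1103 * (n : ℝ) ^ 2) < (TripleSystem.xiSp n : ℝ≥0∞)) ∧
    ∃ ε : ℕ → ℝ, Tendsto ε atTop (𝓝 0) ∧
      (∀ p : ℕ, p.Prime → Odd p →
        (TripleSystem.xiSp (6 * p + 3) : ℝ≥0∞) <
          ENNReal.ofReal ((5 / 36 + ε (6 * p + 3)) * ((6 * p + 3 : ℕ) : ℝ) ^ 2)) ∧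
      {n : ℕ | (TripleSystem.xiSp n : ℝ≥0∞) <
          ENNReal.ofReal ((5 / 36 + ε n) * (n : ℝ) ^ 2)}.Infinite := by
  refine ⟨eventually_atTop.2 ⟨300, fun n hn => TripleSystem.lt_xiSp hn⟩, fun n => 1 / (n : ℝ),
    tendsto_one_div_atTop_nhds_zero_nat,
    fun p hp hodd => TripleSystem.xiSp_six_mul_add_three_lt hp hodd, ?_⟩
  rw [Set.infinite_iff_exists_gt]
  intro a
  obtain ⟨p, hap, hp⟩ := Nat.exists_infinite_primes (a + 3)
  refine ⟨6 * p + 3, ?_, by omega⟩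
  exact TripleSystem.xiSp_six_mul_add_three_lt hp (hp.odd_of_ne_two (by omega))
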